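/- **Setting.** Let $\mathfrak M$ be the algebra of Borel subsets of $[0,1]$ modulo Lebesgue null sets and $\lambda$ Lebesgue measure on it. Let $d(A)=\lim_n |A\cap\{0,\dots,n\}|/(n+1)$ be asymptotic density and $\mathcal Z$ the ideal of subsets of $\omega$ of density $0$. Fix a partition $(B_n)_{n\in\omega}$ of $\omega$ into infinite pairwise disjoint sets $B_n=\{x^n_0<x^n_1<\cdots\}$, and write $A^n=\{x^n_i: i\in A\}$ for $A\subseteq\omega$. For a subalgebra $\mathbb B$ of $\mathcal P(\omega)$ with a finitely additive probability measure $m$, a map $\varphi:\mathfrak M\to\mathbb B$ *witnesses that $(\mathfrak M,\lambda)$ is metrically isomorphic to $(\mathbb B,m)$* if $M\mapsto[\varphi(M)]$ is a measure preserving isomorphism of $\mathfrak M$ onto $\mathbb B/\{A\in\mathbb B: m(A)=0\}$. The pairs $(\mathbb B^{(\alpha)},\mu^{(\alpha)})$, $1\le\alpha<\omega_1$, are obtained recursively, with arbitrary choices at each stage, as follows. * $\alpha=1$: let $\varphi:\mathfrak M\to\mathcal P(\omega)$ be such that $M\mapsto[\varphi(M)]_{\mathcal Z}$ is a homomorphism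 of Boolean algebras into $\mathcal P(\omega)/\mathcal Z$ and $d(\varphi(M))=\lambda(M)$ for every $M$; $\mathbb B^{(1)}$ is the algebra generated by $\mathcal Z\cup\{\varphi(M): M\in\mathfrak M\}$ and $\mu^{(1)}=d$. * $\alpha>1$: let $(\alpha_n)_n$ be a non-decreasing sequence of non-zero ordinals with $\alpha=\sup_n(\alpha_n+1)$ (for instance $\alpha_n=\beta$ for all $n$ if $\alpha=\beta+1$, or $(\alpha_n)_n$ increasing and cofinal in $\alpha$ if $\alpha$ is a limit); let $(\mathbb B_n,\mu_n)$ be a pair obtained at stage $\alpha_n$, and let $\varphi_n$ witness that $(\mathfrak M,\lambda)$ is metrically isomorphic to $(\mathbb B_n,\mu_n)$. Then $\mathbb B^{(\alpha)}$ is the algebra generated by the sets $A\subseteq\omega$ such that $A_{(n)}:=\{i: x^n_i\in A\}\in\mathbb B_n$ for all $n$ and $\lim_n\mu_n(A_{(n)})=1$, together with the sets $\bigcup_n\varphi_n(M)^n$, $M\in\mathfrak M$; and $\mu^{(\alpha)}(A)=\lim_n\mu_n(A_{(n)})$. Let $K=K^{(\alpha)}$ be the Stone space of $\mathbb B^{(\alpha)}$,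 identify $A\in\mathbb B^{(\alpha)}$ with the corresponding clopen set $\widehat A\subseteq K$, and let $\mu$ be the unique Radon measure on $K$ with $\mu(\widehat A)=\mu^{(\alpha)}(A)$ for all $A\in\mathbb B^{(\alpha)}$. Let $S_0(K)$ be the set of finitely supported probability measures on $K$; for $0<\gamma\le\omega_1$ let $S_\gamma(K)$ be the set of Radon probability measures that are weak$^*$ limits of sequences from $\bigcup_{\beta<\gamma}S_\beta(K)$; and let $S(K)=S_{\omega_1}(K)$. Put $U=\bigcup_n\widehat{B_n}$ if $\alpha\ge2$ and $U=\bigcup_n\widehat{\{n\}}$ if $\alpha=1$. For a Radon probability measure $\nu$ on $K$ let $\nu^2$ be the non-atomic part of the restriction of $\nu$ to $K\setminus U$; $\nu$ is *almost absolutely continuous* with respect to $\mu$, written $\nu\ll^*\mu$, if $\nu^2\ll\mu$, i.e. every $\mu$-null Borel set is $\nu^2$-null. **Corollary.** For every $1\le\alpha<\omega_1$, every $K=K^{(\alpha)}$ with its measure $\mu$ as above, and every $\nu\in S(K)$, one has $\nu\ll^*\mu$. -/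

import Mathlib

open MeasureTheory Set Filter Topology
open scoped symmDiff NNReal

/-- The set `A` has asymptotic density `r`: `|A ∩ {0, …, n}| / (n + 1) → r`. -/
def HasDensity (A : Set ℕ) (r : ℝ) : Prop :=
  Tendsto (fun n : ℕ => ((A ∩ Set.Iic n).ncard : ℝ) / ((n : ℝ) + 1)) atTop (𝓝 r)

/-- The map `φ` induces a homomorphism of Boolean algebras `M ↦ [φ M]` from the measure algebra of
the unit interval (Borel sets modulo Lebesgue null sets) to sets of natural numbers modulo `N`.
A map on the measure algebra is given as a map on Borel sets which takes the same value on two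
sets that are almost everywhere equal (its values at other sets are irrelevant). -/
structure IsHomModulo (N : Set (Set ℕ)) (φ : Set unitInterval → Set ℕ) : Prop where
  congr : ∀ s t, MeasurableSet s → MeasurableSet t → s =ᵐ[volume] t → φ s = φ t
  union : ∀ s t, MeasurableSet s → MeasurableSet t → φ (s ∪ t) ∆ (φ s ∪ φ t) ∈ N
  compl : ∀ s, MeasurableSet s → φ sᶜ ∆ (φ s)ᶜ ∈ N

/-- The map `φ` witnesses that the measure algebra of the unit interval with Lebesgue measure is
metrically isomorphic to `(𝔹, m)`: it takes values in `𝔹` and induces a measure preserving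
isomorphism onto the quotient of `𝔹` by its ideal of `m`-null sets (injectivity follows from
the preservation of measure). -/
structure IsMetricIso (𝔹 : BooleanSubalgebra (Set ℕ)) (m : Set ℕ → ℝ)
    (φ : Set unitInterval → Set ℕ) : Prop where
  mem : ∀ s, MeasurableSet s → φ s ∈ 𝔹
  hom : IsHomModulo {A | A ∈ 𝔹 ∧ m A = 0} φ
  measure : ∀ s, MeasurableSet s → m (φ s) = volume.real s
  surj : ∀ A ∈ 𝔹, ∃ s, MeasurableSet s ∧ m (A ∆ φ s) = 0

/-- The copy `Aⁿ = {xⁿ_i : i ∈ A}` of `A` inside `B n = {xⁿ_0 < xⁿ_1 < ⋯}`. -/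
def copyIn (B : ℕ → Set ℕ) (n : ℕ) (A : Set ℕ) : Set ℕ :=
  Nat.nth (fun k => k ∈ B n) '' A

/-- The trace `{i : xⁿ_i ∈ A}` of `A` on `B n = {xⁿ_0 < xⁿ_1 < ⋯}`. It is the set whose copy
inside `B n` is `A ∩ B n`. -/
def traceOn (B : ℕ → Set ℕ) (n : ℕ) (A : Set ℕ) : Set ℕ :=
  {i | Nat.nth (fun k => k ∈ B n) i ∈ A}

/-- The algebra constructed canonically from algebras `𝔹s n` with measures `ms n` and metric
isomorphisms `φs n`. It is generated by the sets `A` such that the trace of `A` on each `B n` is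
in `𝔹s n` and the measures of these traces converge to `1`, and by the sets `⋃ n, (φs n M)ⁿ`. -/
def canonicalAlgebra (B : ℕ → Set ℕ) (𝔹s : ℕ → BooleanSubalgebra (Set ℕ))
    (ms : ℕ → Set ℕ → ℝ) (φs : ℕ → Set unitInterval → Set ℕ) : BooleanSubalgebra (Set ℕ) :=
  BooleanSubalgebra.closure
    ({A | (∀ n, traceOn B n A ∈ 𝔹s n) ∧
        Tendsto (fun n => ms n (traceOn B n A)) atTop (𝓝 1)} ∪
      {A | ∃ s, MeasurableSet s ∧ A = ⋃ n, copyIn B n (φs n s)})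

/-- `IsStage B α 𝔹 m`: the algebra `𝔹` of sets of natural numbers with the finitely additive
measure `m` (only the values of `m` on `𝔹` matter) is a possible outcome of the `α`-th stage
of the construction based on the partition `B`, so that the Stone space of `𝔹` is `K^(α)`.

* Stage `1`: `𝔹` is generated by the sets of density zero and the values of a density preserving
  map `φ` which is a homomorphism modulo sets of density zero, and `m` is the density.
* Later stages: `(𝔹, m)` is constructed canonically from pairs `(𝔹s n, ms n)` of stages `a n`,
  with `a` non-decreasing. The new stage `sup (a n + 1)` is `β + 1` if `a` is
  constantly `β`, and `sup (a n)` if this supremum is not attained. -/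
inductive IsStage (B : ℕ → Set ℕ) :
    Ordinal.{0} → BooleanSubalgebra (Set ℕ) → (Set ℕ → ℝ) → Prop
  | one {α : Ordinal.{0}} {𝔹 : BooleanSubalgebra (Set ℕ)} {m : Set ℕ → ℝ}
      (hα : α = 1)
      (φ : Set unitInterval → Set ℕ)
      (hφ : IsHomModulo {Z | HasDensity Z 0} φ)
      (hφd : ∀ s, MeasurableSet s → HasDensity (φ s) (volume.real s))
      (h𝔹 : 𝔹 = BooleanSubalgebra.closure
        ({Z | HasDensity Z 0} ∪ {A | ∃ s, MeasurableSet s ∧ A = φ s}))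
      (hm : ∀ A ∈ 𝔹, HasDensity A (m A)) :
      IsStage B α 𝔹 m
  | step {α : Ordinal.{0}} {𝔹 : BooleanSubalgebra (Set ℕ)} {m : Set ℕ → ℝ}
      (a : ℕ → Ordinal.{0}) (ha : Monotone a)
      (𝔹s : ℕ → BooleanSubalgebra (Set ℕ)) (ms : ℕ → Set ℕ → ℝ)
      (φs : ℕ → Set unitInterval → Set ℕ)
      (hs : ∀ n, IsStage B (a n) (𝔹s n) (ms n))
      (hφs : ∀ n, IsMetricIso (𝔹s n) (ms n) (φs n))
      (hα : α = ⨆ n, (a n + 1))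
      (h𝔹 : 𝔹 = canonicalAlgebra B 𝔹s ms φs)
      (hm : ∀ A ∈ 𝔹, Tendsto (fun n => ms n (traceOn B n A)) atTop (𝓝 (m A))) :
      IsStage B α 𝔹 m

/-- The sets `B n` used for the decomposition of measures on `K^(α)`: the fixed partition for
`α ≥ 2`, and the singletons `{n}` for `α = 1`. -/
noncomputable def block (B : ℕ → Set ℕ) (α : Ordinal.{0}) (n : ℕ) : Set ℕ :=
  open Classical in if α = 1 then {n} else B n

/-- The collection `u` is an ultrafilter on the algebra `𝔹`. -/
structure IsUltrafilterOn (𝔹 : BooleanSubalgebra (Set ℕ)) (u : Set (Set ℕ)) : Prop where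
  subset : ∀ A ∈ u, A ∈ 𝔹
  univ_mem : Set.univ ∈ u
  empty_notMem : ∅ ∉ u
  inter_mem : ∀ A ∈ u, ∀ C ∈ u, A ∩ C ∈ u
  mem_of_superset : ∀ A ∈ u, ∀ C ∈ 𝔹, A ⊆ C → C ∈ u
  mem_or_compl_mem : ∀ A ∈ 𝔹, A ∈ u ∨ Aᶜ ∈ u

/-- The Stone space of `𝔹`: the set of all ultrafilters on `𝔹`. -/
def StoneSpace (𝔹 : BooleanSubalgebra (Set ℕ)) : Type :=
  {u : Set (Set ℕ) // IsUltrafilterOn 𝔹 u}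

/-- The clopen subset of the Stone space that corresponds to `A`. -/
def stoneClopen (𝔹 : BooleanSubalgebra (Set ℕ)) (A : Set ℕ) : Set (StoneSpace 𝔹) :=
  {u | A ∈ u.1}

/-- The Stone topology. -/
instance instTopologicalSpaceStoneSpace (𝔹 : BooleanSubalgebra (Set ℕ)) :
    TopologicalSpace (StoneSpace 𝔹) :=
  TopologicalSpace.generateFrom {U | ∃ A ∈ 𝔹, U = stoneClopen 𝔹 A}

instance instMeasurableSpaceStoneSpace (𝔹 : BooleanSubalgebra (Set ℕ)) :
    MeasurableSpace (StoneSpace 𝔹) :=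
  borel (StoneSpace 𝔹)

instance instBorelSpaceStoneSpace (𝔹 : BooleanSubalgebra (Set ℕ)) :
    BorelSpace (StoneSpace 𝔹) :=
  ⟨rfl⟩

/-- The Borel measure `μ` is the (unique) Radon extension to the Stone space of the finitely
additive measure `m` on `𝔹`. -/
structure IsRadonExtension (𝔹 : BooleanSubalgebra (Set ℕ)) (m : Set ℕ → ℝ)
    (μ : Measure (StoneSpace 𝔹)) : Prop where
  regular : μ.Regular
  extends_content : ∀ A ∈ 𝔹, μ (stoneClopen 𝔹 A) = ENNReal.ofReal (m A)

/-- The sequential hierarchy: `InSeqHierarchy A α ν` says that `ν ∈ S_α(A)`. Here `S_0(A)`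
consists of the probability measures that are convex combinations of Dirac measures at finitely
many points of `A`, and, for `α > 0`, `S_α(A)` consists of the Radon probability measures that
are weak* limits of sequences from `⋃ β < α, S_β(A)`. (Mathlib's topology on `ProbabilityMeasure K`
is that of convergence of the integrals of all bounded continuous functions.) -/
inductive InSeqHierarchy {K : Type*} [TopologicalSpace K] [MeasurableSpace K]
    [OpensMeasurableSpace K] (A : Set K) : Ordinal.{0} → ProbabilityMeasure K → Prop
  | finite {ν : ProbabilityMeasure K} (s : Finset K) (w : K → ℝ≥0)
      (hs : ∀ x ∈ s, x ∈ A) (hw : ∑ x ∈ s, w x = 1)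
      (hν : (ν : Measure K) = ∑ x ∈ s, w x • Measure.dirac x) :
      InSeqHierarchy A 0 ν
  | limit {α : Ordinal.{0}} {ν : ProbabilityMeasure K} (hν : (ν : Measure K).Regular)
      (σ : ℕ → ProbabilityMeasure K) (β : ℕ → Ordinal.{0}) (hβ : ∀ n, β n < α)
      (hσ : ∀ n, InSeqHierarchy A (β n) (σ n)) (hlim : Tendsto σ atTop (𝓝 ν)) :
      InSeqHierarchy A α ν

/-- The sequential closure `S(K) = S_{ω₁}(K)` of the set of finitely supported probability
measures on `K`. -/
def seqClosureOfFinite (K : Type*) [TopologicalSpace K] [MeasurableSpace K]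
    [OpensMeasurableSpace K] : Set (ProbabilityMeasure K) :=
  {ν | InSeqHierarchy (Set.univ : Set K) (Ordinal.omega 1) ν}

/-- The non-atomic part of a finite Radon measure `ν`: what remains after removing the atomic
part `∑ ν {x} δ_x`, that is, the restriction of `ν` to the (co-countable) set of points of
measure zero. -/
noncomputable def nonatomicPart {K : Type*} [MeasurableSpace K] (ν : Measure K) : Measure K :=
  ν.restrict {x | ν {x} = 0}

/-- Almost absolute continuity of `ν` with respect to `ρ`, for the decomposition
`ν = ν⁰ + ν¹ + ν²` in which `ν⁰` is the restriction of `ν` to `U`, and `ν¹` and `ν²` are the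
atomic and the non-atomic part of the restriction of `ν` to the complement of `U`:
it means that `ν²` is absolutely continuous with respect to `ρ`. -/
def AlmostAbsolutelyContinuous {K : Type*} [MeasurableSpace K] (U : Set K) (ν ρ : Measure K) :
    Prop :=
  nonatomicPart (ν.restrict Uᶜ) ≪ ρ

/-!
All stages of the construction have the same form. There is a sequence of finitely additive
probability measures `pₙ` on an algebra of sets, a sequence of blocks `bⱼ` such that `pₙ` is carried
by `b₀, …, bₙ` and `pₙ(bⱼ) → 0` for each `j`, and a map from Borel subsets of the unit interval to
sets of natural numbers which is a measure preserving homomorphism in the limit; the stage consists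
of the sets `A` with `pₙ(A ∆ lift s) → 0` for some `s`, and its measure is `lim pₙ`. At stage `1`,
`pₙ` is the uniform measure on `{0, …, n}` and the blocks are singletons; at later stages, `pₙ`
lives on the block `B n` (`IsStage.exists_chargeSequence`). No induction on the stage is needed
apart from the finite additivity of the measures.

The completeness of the measure algebra of the unit interval gives a weak form of
`σ`-completeness: if `X k` is disjoint from the first `k` blocks and `pₙ(X k) ≤ 2⁻ᵏ` for all `n`,
then the union of the `X k` is in the algebra (`ChargeSequence.iUnion_mem_algebra`). Moreover,
each set of limit measure less than `2⁻ᵏ` becomes small in this sense after the removal of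
finitely many blocks (`ChargeSequence.exists_isSmall_sdiff`), which does not affect the points of
the Stone space outside of `U`.

Let `σ n → ν` weakly*, and let `C` be a compact subset of the complement of `U` which is null for
`μ` and for all the `σ n`. Then `ν C = 0`. Otherwise one finds a decreasing sequence of small clopen
neighbourhoods `A k` of `C` and indices `n k` such that `σ (n k)` gives mass almost `ν C` or more
to `A k`, but hardly any to `A (k + 1)`, hence mass almost `ν C` or more to the hump
`A k \ A (k + 1)`. The union of the humps with even `k` is in the algebra, but its measures under
`σ (n k)` oscillate, which contradicts weak* convergence
(`ChargeSequence.nonpos_of_forall_le`, `ChargeSequence.measure_eq_zero_of_tendsto`).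

Consequently, the property that all `μ`-null Borel subsets of the complement of `U` without atoms
of `ν` are `ν`-null is inherited by Radon limits of sequences, since the countably many atoms of the
`σ n` can be removed from such a set. Finitely supported measures have it trivially, so induction
on the sequential hierarchy finishes the proof
(`ChargeSequence.isNullOffAtoms_of_inSeqHierarchy`).
-/

/-! ### Finitely additive probability measures on algebras of sets -/

/-- `m` is a finitely additive probability measure on the algebra `𝔸` (its values outside `𝔸` are
irrelevant). -/
structure IsCharge (𝔸 : BooleanSubalgebra (Set ℕ)) (m : Set ℕ → ℝ) : Prop where
  nonneg : ∀ A ∈ 𝔸, 0 ≤ m A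
  union : ∀ A ∈ 𝔸, ∀ C ∈ 𝔸, Disjoint A C → m (A ∪ C) = m A + m C
  univ : m Set.univ = 1

section Membership

variable {𝔸 : BooleanSubalgebra (Set ℕ)} {A C : Set ℕ}

theorem BooleanSubalgebra.empty_mem : (∅ : Set ℕ) ∈ 𝔸 := BooleanSubalgebra.bot_mem

theorem BooleanSubalgebra.univ_mem : (Set.univ : Set ℕ) ∈ 𝔸 := BooleanSubalgebra.top_mem

theorem BooleanSubalgebra.union_mem (hA : A ∈ 𝔸) (hC : C ∈ 𝔸) : A ∪ C ∈ 𝔸 :=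
  BooleanSubalgebra.sup_mem hA hC

theorem BooleanSubalgebra.inter_mem (hA : A ∈ 𝔸) (hC : C ∈ 𝔸) : A ∩ C ∈ 𝔸 :=
  BooleanSubalgebra.inf_mem hA hC

theorem BooleanSubalgebra.symmDiff_mem (hA : A ∈ 𝔸) (hC : C ∈ 𝔸) : A ∆ C ∈ 𝔸 :=
  BooleanSubalgebra.union_mem (BooleanSubalgebra.sdiff_mem hA hC)
    (BooleanSubalgebra.sdiff_mem hC hA)

theorem BooleanSubalgebra.biUnion_lt_mem {X : ℕ → Set ℕ} (hX : ∀ k, X k ∈ 𝔸) (n : ℕ) :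
    (⋃ k < n, X k) ∈ 𝔸 := by
  induction n with
  | zero => simpa using BooleanSubalgebra.empty_mem
  | succ n ih =>
    rw [Set.biUnion_lt_succ]
    exact BooleanSubalgebra.union_mem ih (hX n)

end Membership

namespace IsCharge

open BooleanSubalgebra

variable {𝔸 : BooleanSubalgebra (Set ℕ)} {m : Set ℕ → ℝ} {A C : Set ℕ}

theorem empty (h : IsCharge 𝔸 m) : m ∅ = 0 := by
  have := h.union ∅ empty_mem ∅ empty_mem (by simp)
  simp at this
  exact this

theorem add_sdiff (h : IsCharge 𝔸 m) (hA : A ∈ 𝔸) (hC : C ∈ 𝔸) (hAC : A ⊆ C) :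
    m C = m A + m (C \ A) := by
  rw [← h.union A hA _ (sdiff_mem hC hA) disjoint_sdiff_right, Set.union_sdiff_cancel hAC]

theorem mono (h : IsCharge 𝔸 m) (hA : A ∈ 𝔸) (hC : C ∈ 𝔸) (hAC : A ⊆ C) : m A ≤ m C := by
  rw [h.add_sdiff hA hC hAC]
  linarith [h.nonneg _ (sdiff_mem hC hA)]

theorem union_le (h : IsCharge 𝔸 m) (hA : A ∈ 𝔸) (hC : C ∈ 𝔸) : m (A ∪ C) ≤ m A + m C := by
  rw [← Set.union_sdiff_self, h.union A hA _ (sdiff_mem hC hA) disjoint_sdiff_right]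
  linarith [h.mono (sdiff_mem hC hA) hC Set.sdiff_subset]

theorem compl (h : IsCharge 𝔸 m) (hA : A ∈ 𝔸) : m Aᶜ = 1 - m A := by
  have := h.add_sdiff hA univ_mem (Set.subset_univ A)
  rw [h.univ, ← Set.compl_eq_univ_sdiff] at this
  linarith

end IsCharge

/-! ### Algebras obtained as limits of a sequence of charges -/

/-- The common form of all stages of the construction: a sequence `charge n` of charges on an
algebra `domain` such that `charge n` is supported by the first `n + 1` of the sets `block j`, each
of which is asymptotically negligible, and a map `lift` which in the limit becomes a measure
preserving homomorphism of the measure algebra of the unit interval. At stage `1`, `charge n` is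
the normalized counting measure on `{0, …, n}` and `block j = {j}`; at later stages, `charge n` is
the `n`-th of the given measures, transported to `block n = B n`. -/
structure ChargeSequence where
  domain : BooleanSubalgebra (Set ℕ)
  charge : ℕ → Set ℕ → ℝ
  block : ℕ → Set ℕ
  lift : Set unitInterval → Set ℕ
  isCharge : ∀ n, IsCharge domain (charge n)
  block_mem : ∀ j, block j ∈ domain
  tendsto_block : ∀ j, Tendsto (fun n => charge n (block j)) atTop (𝓝 0)
  charge_eq_zero : ∀ n, ∀ A ∈ domain, (∀ j ≤ n, Disjoint A (block j)) → charge n A = 0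
  iUnion_mem : ∀ X : ℕ → Set ℕ, (∀ k, X k ∈ domain) → (∀ k, ∀ j < k, Disjoint (X k) (block j)) →
    ⋃ k, X k ∈ domain
  lift_mem : ∀ s, MeasurableSet s → lift s ∈ domain
  tendsto_lift : ∀ s, MeasurableSet s →
    Tendsto (fun n => charge n (lift s)) atTop (𝓝 (volume.real s))
  lift_union : ∀ s t, MeasurableSet s → MeasurableSet t →
    Tendsto (fun n => charge n (lift (s ∪ t) ∆ (lift s ∪ lift t))) atTop (𝓝 0)
  lift_compl : ∀ s, MeasurableSet s →
    Tendsto (fun n => charge n (lift sᶜ ∆ (lift s)ᶜ)) atTop (𝓝 0)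

namespace ChargeSequence

open BooleanSubalgebra

variable (S : ChargeSequence) {A C : Set ℕ} {s t : Set unitInterval}

/-- The sets which are asymptotically null for the sequence of charges. -/
def IsNull (A : Set ℕ) : Prop :=
  A ∈ S.domain ∧ Tendsto (fun n => S.charge n A) atTop (𝓝 0)

variable {S}

theorem IsNull.mono (hC : S.IsNull C) (hA : A ∈ S.domain) (hAC : A ⊆ C) : S.IsNull A :=
  ⟨hA, squeeze_zero (fun n => (S.isCharge n).nonneg A hA)
    (fun n => (S.isCharge n).mono hA hC.1 hAC) hC.2⟩

theorem IsNull.union (hA : S.IsNull A) (hC : S.IsNull C) : S.IsNull (A ∪ C) :=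
  ⟨union_mem hA.1 hC.1, squeeze_zero (fun n => (S.isCharge n).nonneg _ (union_mem hA.1 hC.1))
    (fun n => (S.isCharge n).union_le hA.1 hC.1) (by simpa using hA.2.add hC.2)⟩

variable (S) in
theorem isNull_lift_union (hs : MeasurableSet s) (ht : MeasurableSet t) :
    S.IsNull (S.lift (s ∪ t) ∆ (S.lift s ∪ S.lift t)) :=
  ⟨symmDiff_mem (S.lift_mem _ (hs.union ht)) (union_mem (S.lift_mem _ hs) (S.lift_mem _ ht)),
    S.lift_union s t hs ht⟩

variable (S) in
theorem isNull_lift_compl (hs : MeasurableSet s) :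
    S.IsNull (S.lift sᶜ ∆ (S.lift s)ᶜ) :=
  ⟨symmDiff_mem (S.lift_mem _ hs.compl) (compl_mem (S.lift_mem _ hs)), S.lift_compl s hs⟩

variable (S) in
theorem isNull_lift_empty : S.IsNull (S.lift ∅) :=
  ⟨S.lift_mem _ .empty, by simpa using S.tendsto_lift ∅ .empty⟩

theorem isNull_union_symmDiff (hs : MeasurableSet s) (ht : MeasurableSet t) (hA : A ∈ S.domain)
    (hC : C ∈ S.domain) (hAs : S.IsNull (A ∆ S.lift s)) (hCt : S.IsNull (C ∆ S.lift t)) :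
    S.IsNull ((A ∪ C) ∆ S.lift (s ∪ t)) := by
  refine ((hAs.union hCt).union (S.isNull_lift_union hs ht)).mono
    (symmDiff_mem (union_mem hA hC) (S.lift_mem _ (hs.union ht))) fun x hx => ?_
  simp only [Set.mem_symmDiff, Set.mem_union] at hx ⊢
  tauto

variable (S) in
/-- The sets in the domain which agree with a lift up to an asymptotically null set. -/
def algebra : BooleanSubalgebra (Set ℕ) where
  carrier := {A | A ∈ S.domain ∧ ∃ s, MeasurableSet s ∧ S.IsNull (A ∆ S.lift s)}
  supClosed' := by
    rintro A ⟨hA, s, hs, hAs⟩ C ⟨hC, t, ht, hCt⟩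
    exact ⟨union_mem hA hC, s ∪ t, hs.union ht, isNull_union_symmDiff hs ht hA hC hAs hCt⟩
  infClosed' := by
    rintro A ⟨hA, s, hs, hAs⟩ C ⟨hC, t, ht, hCt⟩
    refine ⟨inter_mem hA hC, (sᶜ ∪ tᶜ)ᶜ, (hs.compl.union ht.compl).compl, ?_⟩
    refine ((((hAs.union hCt).union (S.isNull_lift_union hs.compl ht.compl)).union
      ((S.isNull_lift_compl hs).union (S.isNull_lift_compl ht))).union
      (S.isNull_lift_compl (hs.compl.union ht.compl))).mono
      (symmDiff_mem (inter_mem hA hC) (S.lift_mem _ (hs.compl.union ht.compl).compl))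
      fun x hx => ?_
    simp only [Set.mem_symmDiff, Set.mem_union, Set.mem_compl_iff, Set.inf_eq_inter,
      Set.mem_inter_iff] at hx ⊢
    tauto
  compl_mem' := by
    rintro A ⟨hA, s, hs, hAs⟩
    refine ⟨compl_mem hA, sᶜ, hs.compl, (hAs.union (S.isNull_lift_compl hs)).mono
      (symmDiff_mem (compl_mem hA) (S.lift_mem _ hs.compl)) fun x hx => ?_⟩
    simp only [Set.mem_symmDiff, Set.mem_union, Set.mem_compl_iff] at hx ⊢
    tauto
  bot_mem' := by
    refine ⟨bot_mem, ∅, .empty, S.isNull_lift_empty.mono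
      (symmDiff_mem empty_mem (S.lift_mem _ .empty)) fun x hx => ?_⟩
    simpa [Set.mem_symmDiff] using hx

theorem lift_mem_algebra (hs : MeasurableSet s) : S.lift s ∈ S.algebra :=
  ⟨S.lift_mem s hs, s, hs, by simpa using S.isNull_lift_empty.mono empty_mem (empty_subset _)⟩

theorem IsNull.mem_algebra (hA : S.IsNull A) : A ∈ S.algebra :=
  ⟨hA.1, ∅, .empty, (hA.union S.isNull_lift_empty).mono
    (symmDiff_mem hA.1 (S.lift_mem _ .empty)) symmDiff_le_sup⟩

theorem block_mem_algebra (j : ℕ) : S.block j ∈ S.algebra :=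
  IsNull.mem_algebra ⟨S.block_mem j, S.tendsto_block j⟩

variable (S) in
/-- A set is `k`-small if it avoids the first `k` blocks and has measure at most `2⁻ᵏ` for all the
charges. -/
def IsSmall (k : ℕ) (A : Set ℕ) : Prop :=
  (∀ j < k, Disjoint A (S.block j)) ∧ ∀ n, S.charge n A ≤ (1 / 2) ^ k

theorem IsSmall.mono {k : ℕ} (hC : S.IsSmall k C) (hA : A ∈ S.domain) (hC' : C ∈ S.domain)
    (hAC : A ⊆ C) : S.IsSmall k A :=
  ⟨fun j hj => (hC.1 j hj).mono_left hAC,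
    fun n => ((S.isCharge n).mono hA hC' hAC).trans (hC.2 n)⟩

/-- Every set of small limit measure becomes small after the removal of finitely many blocks. -/
theorem exists_isSmall_sdiff (hA : A ∈ S.algebra) {k : ℕ} {r : ℝ}
    (hr : Tendsto (fun n => S.charge n A) atTop (𝓝 r)) (hrk : r < (1 / 2) ^ k) :
    ∃ N, S.IsSmall k (A \ ⋃ j < N, S.block j) := by
  obtain ⟨N, hN⟩ := eventually_atTop.1 (hr.eventually_lt_const hrk)
  have hmem : A \ (⋃ j < max N k, S.block j) ∈ S.domain :=
    sdiff_mem hA.1 (biUnion_lt_mem S.block_mem _)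
  have hdisj : ∀ j < max N k, Disjoint (A \ ⋃ j < max N k, S.block j) (S.block j) := fun j hj =>
    disjoint_sdiff_left.mono_right (Set.subset_biUnion_of_mem (u := fun j => S.block j) hj)
  refine ⟨max N k, fun j hj => hdisj j (hj.trans_le (le_max_right _ _)), fun n => ?_⟩
  rcases lt_or_ge n N with hn | hn
  · rw [S.charge_eq_zero n _ hmem fun j hj => hdisj j ((hj.trans_lt hn).trans_le (le_max_left _ _))]
    positivity
  · exact ((S.isCharge n).mono hmem hA.1 Set.sdiff_subset).trans (hN n hn).le

/-- Unions of sequences of small sets are uniformly small: at each `n`, only finitely many of the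
sets matter for `charge n`. -/
theorem charge_iUnion_ge_le {X : ℕ → Set ℕ} (hX : ∀ k, X k ∈ S.domain)
    (hsmall : ∀ k, S.IsSmall k (X k)) (L : ℕ) :
    (⋃ k ≥ L, X k) ∈ S.domain ∧ ∀ n, S.charge n (⋃ k ≥ L, X k) ≤ 2 * (1 / 2) ^ L := by
  have hmem : ∀ L, (⋃ k ≥ L, X k) ∈ S.domain := fun L => by
    refine S.iUnion_mem (fun k => ⋃ (_ : k ≥ L), X k) (fun k => ?_) fun k j hj => ?_
    · by_cases hk : L ≤ k
      · simpa [hk] using hX k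
      · simpa [hk] using empty_mem
    · exact ((hsmall k).1 j hj).mono_left (Set.iUnion_subset fun _ => subset_rfl)
  refine ⟨hmem L, fun n => ?_⟩
  obtain ⟨d, hd⟩ : ∃ d, n < L + d := ⟨n + 1, by omega⟩
  induction d generalizing L with
  | zero =>
    rw [S.charge_eq_zero n _ (hmem L) fun j hj => ?_]
    · positivity
    · simp only [Set.disjoint_iUnion_left]
      exact fun k hk => (hsmall k).1 j (by omega)
  | succ d ih =>
    have heq : (⋃ k ≥ L, X k) = X L ∪ ⋃ k ≥ L + 1, X k := by
      ext x
      simp only [Set.mem_iUnion, Set.mem_union, exists_prop]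
      constructor
      · rintro ⟨k, hk, hx⟩
        rcases eq_or_lt_of_le hk with rfl | hk
        exacts [.inl hx, .inr ⟨k, hk, hx⟩]
      · rintro (hx | ⟨k, hk, hx⟩)
        exacts [⟨L, le_rfl, hx⟩, ⟨k, by omega, hx⟩]
    rw [heq]
    refine ((S.isCharge n).union_le (hX L) (hmem _)).trans ?_
    have h1 := (hsmall L).2 n
    have h2 := ih (L + 1) (by omega)
    rw [pow_succ] at h2
    linarith

theorem isNull_biUnion_lt_symmDiff {X : ℕ → Set ℕ} {s : ℕ → Set unitInterval}
    (hX : ∀ k, X k ∈ S.domain) (hs : ∀ k, MeasurableSet (s k))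
    (hXs : ∀ k, S.IsNull (X k ∆ S.lift (s k))) (L : ℕ) :
    S.IsNull ((⋃ k < L, X k) ∆ S.lift (⋃ k < L, s k)) := by
  induction L with
  | zero =>
    have h : (∅ : Set ℕ) ∆ S.lift ∅ = S.lift ∅ := bot_symmDiff _
    simpa [h] using S.isNull_lift_empty
  | succ L ih =>
    rw [Set.biUnion_lt_succ, Set.biUnion_lt_succ]
    exact isNull_union_symmDiff (.biUnion (Set.to_countable _) fun k _ => hs k) (hs L)
      (biUnion_lt_mem hX L) (hX L) ih (hXs L)

/-- The algebra contains the union of every sequence of sets that are small enough. The union is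
represented by the union of the corresponding sets in the measure algebra. -/
theorem iUnion_mem_algebra {X : ℕ → Set ℕ} (hX : ∀ k, X k ∈ S.algebra)
    (hsmall : ∀ k, S.IsSmall k (X k)) : ⋃ k, X k ∈ S.algebra := by
  choose hdom s hs hXs using hX
  have hmem : ⋃ k, X k ∈ S.domain := S.iUnion_mem X hdom fun k => (hsmall k).1
  have hsm : MeasurableSet (⋃ k, s k) := .iUnion hs
  refine ⟨hmem, ⋃ k, s k, hsm, symmDiff_mem hmem (S.lift_mem _ hsm), ?_⟩
  have hnonneg : ∀ n, 0 ≤ S.charge n ((⋃ k, X k) ∆ S.lift (⋃ k, s k)) := fun n =>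
    (S.isCharge n).nonneg _ (symmDiff_mem hmem (S.lift_mem _ hsm))
  -- Up to a null set, the symmetric difference is covered by the tail of the union of the `X k`
  -- and by the lift of the tail of the union of the `s k`.
  have key : ∀ L, ∃ Z, S.IsNull Z ∧ ∀ n, S.charge n ((⋃ k, X k) ∆ S.lift (⋃ k, s k)) ≤
      S.charge n Z + 2 * (1 / 2) ^ L +
        S.charge n (S.lift ((⋃ k, s k) \ ⋃ k < L, s k)) := fun L => by
    set T := ⋃ k < L, s k with hT
    have hTm : MeasurableSet T := .biUnion (Set.to_countable _) fun k _ => hs k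
    have hTs : T ∪ ((⋃ k, s k) \ T) = ⋃ k, s k :=
      Set.union_sdiff_cancel (Set.iUnion₂_subset fun k _ => Set.subset_iUnion s k)
    have hZ := (isNull_biUnion_lt_symmDiff hdom hs hXs L).union
      (S.isNull_lift_union hTm (hsm.diff hTm))
    rw [hTs] at hZ
    obtain ⟨htail, htail_le⟩ := charge_iUnion_ge_le hdom hsmall L
    have hd := S.lift_mem _ (hsm.diff hTm)
    refine ⟨_, hZ, fun n => ?_⟩
    refine ((S.isCharge n).mono (symmDiff_mem hmem (S.lift_mem _ hsm))
      (union_mem (union_mem hZ.1 htail) hd) fun x hx => ?_).trans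
      (((S.isCharge n).union_le (union_mem hZ.1 htail) hd).trans
        (add_le_add_left (((S.isCharge n).union_le hZ.1 htail).trans
          (add_le_add_right (htail_le n) _)) _))
    have hsplit : x ∈ (⋃ k, X k) ↔ x ∈ (⋃ k < L, X k) ∨ x ∈ (⋃ k ≥ L, X k) := by
      simp only [Set.mem_iUnion, exists_prop]
      constructor
      · rintro ⟨k, hk⟩
        exact (lt_or_ge k L).imp (fun h => ⟨k, h, hk⟩) (fun h => ⟨k, h, hk⟩)
      · rintro (⟨k, _, hk⟩ | ⟨k, _, hk⟩) <;> exact ⟨k, hk⟩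
    rw [Set.mem_symmDiff, hsplit] at hx
    simp only [Set.mem_symmDiff, Set.mem_union]
    tauto
  have htail : Tendsto (fun L => volume.real ((⋃ k, s k) \ ⋃ k < L, s k)) atTop (𝓝 0) := by
    have hacc : ∀ L, MeasurableSet (⋃ k < L, s k) := fun L =>
      .biUnion (Set.to_countable _) fun k _ => hs k
    have h := tendsto_measure_iInter_atTop (μ := volume)
      (s := fun L => (⋃ k, s k) \ ⋃ k < L, s k)
      (fun L => (hsm.diff (hacc L)).nullMeasurableSet)
      (fun L L' hLL' => Set.sdiff_subset_sdiff_right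
        (Set.biUnion_subset_biUnion_left fun k (hk : k < L) => hk.trans_le hLL'))
      ⟨0, measure_ne_top _ _⟩
    have hempty : ⋂ L, ((⋃ k, s k) \ ⋃ k < L, s k) = ∅ := by
      ext x
      simp only [Set.mem_iInter, Set.mem_sdiff, Set.mem_iUnion, Set.mem_empty_iff_false, iff_false,
        not_forall]
      by_cases hx : ∃ k, x ∈ s k
      · obtain ⟨k, hk⟩ := hx
        exact ⟨k + 1, fun h => h.2 ⟨k, k.lt_succ_self, hk⟩⟩
      · exact ⟨0, fun h => hx h.1⟩
    rw [hempty, measure_empty] at h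
    rw [← ENNReal.toReal_zero]
    exact (ENNReal.tendsto_toReal ENNReal.zero_ne_top).comp h
  refine tendsto_order.2 ⟨fun a ha => .of_forall fun n => ha.trans_le (hnonneg n),
    fun ε hε => ?_⟩
  have hpow : Tendsto (fun L : ℕ => 2 * (1 / 2 : ℝ) ^ L) atTop (𝓝 0) := by
    simpa using (tendsto_pow_atTop_nhds_zero_of_lt_one (r := (1 / 2 : ℝ)) (by norm_num)
      (by norm_num)).const_mul 2
  obtain ⟨L, hL⟩ := ((hpow.add htail).eventually_lt_const (by simpa using hε)).exists
  obtain ⟨Z, hZ, hle⟩ := key L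
  have hlim := (hZ.2.add_const (2 * (1 / 2) ^ L)).add
    (S.tendsto_lift _ (hsm.diff (.biUnion (Set.to_countable {k | k < L}) fun k _ => hs k)))
  filter_upwards [hlim.eventually_lt_const (by simpa using hL)] with n hn
  exact (hle n).trans_lt hn

end ChargeSequence

/-! ### The gliding hump -/

/-- Dependent choice with an invariant `P` and a relation `R` between consecutive terms. -/
theorem exists_seq_of_forall_exists {X : Type*} {P : ℕ → X → Prop} {R : ℕ → X → X → Prop}
    (h0 : ∃ x, P 0 x) (hstep : ∀ k x, P k x → ∃ y, P (k + 1) y ∧ R k x y) :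
    ∃ f : ℕ → X, ∀ k, P k (f k) ∧ R k (f k) (f (k + 1)) := by
  obtain ⟨x0, hx0⟩ := h0
  choose! g hg using hstep
  let f : ℕ → X := fun n => Nat.rec x0 g n
  have hf : ∀ k, P k (f k) := fun k => by
    induction k with
    | zero => exact hx0
    | succ k ih => exact (hg k _ ih).1
  exact ⟨f, fun k => ⟨hf k, (hg k _ (hf k)).2⟩⟩

namespace ChargeSequence

open BooleanSubalgebra

variable {S : ChargeSequence}

/-- Let the charges `r n` converge to the charge `ρ` on the algebra, and let `F` be a family of sets
(the clopen neighbourhoods of a fixed compact set) which below each of its members has sets that are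
arbitrarily small, both in the sense of `IsSmall` and for each given `r i`. Then the members of `F`
cannot have `ρ`-measures bounded away from `0`. -/
theorem nonpos_of_forall_le {r : ℕ → Set ℕ → ℝ} {ρ : Set ℕ → ℝ}
    (hr : ∀ n, IsCharge S.algebra (r n)) (hρ : IsCharge S.algebra ρ)
    (hlim : ∀ A ∈ S.algebra, Tendsto (fun n => r n A) atTop (𝓝 (ρ A)))
    {F : Set (Set ℕ)} (hF : F ⊆ S.algebra) (hne : F.Nonempty)
    (hstep : ∀ A ∈ F, ∀ k i, ∀ ε > 0, ∃ A' ∈ F, A' ⊆ A ∧ S.IsSmall k A' ∧ r i A' < ε)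
    {c : ℝ} (hc : ∀ A ∈ F, c ≤ ρ A) : c ≤ 0 := by
  by_contra! hcpos
  set ε := c / 8 with hε
  have hε0 : 0 < ε := by positivity
  -- A large index at which the charge is close to its limit on two given sets.
  have hidx : ∀ (k : ℕ) (A D : Set ℕ), A ∈ F → D ∈ S.algebra →
      ∃ n, k ≤ n ∧ c - ε < r n A ∧ |r n D - ρ D| < ε := fun k A D hA hD => by
    have h1 := (hlim A (hF hA)).eventually_const_lt (show c - ε < ρ A by linarith [hc A hA])
    have h2 := (hlim D hD).eventually (Metric.ball_mem_nhds _ hε0)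
    exact ((eventually_ge_atTop k).and (h1.and h2)).exists
  -- A term `(A, D, n)` of the construction consists of a set `A ∈ F`, the union `D` of the humps
  -- found so far, and an index `n`. The hump `A \ A'` carries almost all of `r n A`; it is
  -- included in the union every other time.
  obtain ⟨f, hf⟩ := exists_seq_of_forall_exists
    (P := fun k (x : Set ℕ × Set ℕ × ℕ) => (x.1 ∈ F ∧ x.2.1 ∈ S.algebra ∧ Disjoint x.1 x.2.1 ∧
      S.IsSmall k x.1) ∧ k ≤ x.2.2 ∧ c - ε < r x.2.2 x.1 ∧ |r x.2.2 x.2.1 - ρ x.2.1| < ε)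
    (R := fun k x y => y.1 ⊆ x.1 ∧ r x.2.2 y.1 < ε ∧
      y.2.1 = if Even k then x.2.1 ∪ (x.1 \ y.1) else x.2.1)
    (by
      obtain ⟨A, hA⟩ := hne
      obtain ⟨A', hA', -, hsm, -⟩ := hstep A hA 0 0 1 one_pos
      obtain ⟨n, hn⟩ := hidx 0 A' ∅ hA' empty_mem
      exact ⟨(A', ∅, n), ⟨hA', empty_mem, disjoint_bot_right, hsm⟩, hn⟩)
    (by
      rintro k ⟨A, D, n⟩ ⟨⟨hA, hD, hAD, -⟩, -⟩
      dsimp only at hA hD hAD ⊢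
      obtain ⟨A', hA', hsub, hsm, hlt⟩ := hstep A hA (k + 1) n ε hε0
      set D' := if Even k then D ∪ (A \ A') else D with hD'def
      have hD' : D' ∈ S.algebra := by
        rw [hD'def]; split_ifs
        exacts [union_mem hD (sdiff_mem (hF hA) (hF hA')), hD]
      have hdisj : Disjoint A' D' := by
        rw [hD'def]; split_ifs
        exacts [(hAD.mono_left hsub).sup_right disjoint_sdiff_right, hAD.mono_left hsub]
      obtain ⟨n', hn'⟩ := hidx (k + 1) A' D' hA' hD'
      exact ⟨(A', D', n'), ⟨⟨hA', hD', hdisj, hsm⟩, hn'⟩, hsub, hlt, hD'def⟩)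
  choose A D n hAD using fun k => (⟨_, _, _, rfl⟩ : ∃ A D n, f k = (A, D, n))
  simp only [hAD] at hf
  have hAF : ∀ k, A k ∈ F := fun k => (hf k).1.1.1
  have hAm : ∀ k, A k ∈ S.algebra := fun k => hF (hAF k)
  have hDm : ∀ k, D k ∈ S.algebra := fun k => (hf k).1.1.2.1
  have hdisj : ∀ k, Disjoint (A k) (D k) := fun k => (hf k).1.1.2.2.1
  have hsmall : ∀ k, S.IsSmall k (A k) := fun k => (hf k).1.1.2.2.2
  have hn : ∀ k, k ≤ n k := fun k => (hf k).1.2.1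
  have hbig : ∀ k, c - ε < r (n k) (A k) := fun k => (hf k).1.2.2.1
  have hclose : ∀ k, |r (n k) (D k) - ρ (D k)| < ε := fun k => (hf k).1.2.2.2
  have hsub : ∀ k, A (k + 1) ⊆ A k := fun k => (hf k).2.1
  have hnext : ∀ k, r (n k) (A (k + 1)) < ε := fun k => (hf k).2.2.1
  have hDsucc : ∀ k, D (k + 1) = if Even k then D k ∪ (A k \ A (k + 1)) else D k :=
    fun k => (hf k).2.2.2
  have hanti : Antitone A := antitone_nat_of_succ_le hsub
  have hDmono : Monotone D := monotone_nat_of_le_succ fun k => by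
    rw [hDsucc]; split_ifs
    exacts [Set.subset_union_left, le_rfl]
  -- The union of the humps with even index. Adding `D 0`, which could be any set disjoint from
  -- `A 0`, makes it unnecessary to record that the construction starts with the empty set.
  set E := D 0 ∪ ⋃ k, (if Even k then A k \ A (k + 1) else ∅) with hEdef
  have hE : E ∈ S.algebra := by
    refine union_mem (hDm 0) (iUnion_mem_algebra (fun k => ?_) fun k =>
      (hsmall k).mono ?_ (hAm k).1 ?_)
    · split_ifs
      exacts [sdiff_mem (hAm k) (hAm _), empty_mem]
    · split_ifs
      exacts [sdiff_mem (hAm k).1 (hAm _).1, empty_mem]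
    · split_ifs
      exacts [Set.sdiff_subset, Set.empty_subset _]
  have hEsub : ∀ k, E ⊆ D k ∪ A k := fun k => by
    refine Set.union_subset ((hDmono k.zero_le).trans Set.subset_union_left)
      (Set.iUnion_subset fun j => ?_)
    split_ifs with hj
    · rcases lt_or_ge j k with hjk | hjk
      · refine Set.Subset.trans ?_ ((hDmono (Nat.succ_le_of_lt hjk)).trans Set.subset_union_left)
        rw [hDsucc, if_pos hj]
        exact Set.subset_union_right
      · exact (Set.sdiff_subset.trans (hanti hjk)).trans Set.subset_union_right
    · exact Set.empty_subset _
  have hhump : ∀ k, Even k → A k \ A (k + 1) ⊆ E := fun k hk x hx =>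
    .inr (Set.mem_iUnion.2 ⟨k, by rwa [if_pos hk]⟩)
  have hsubE : ∀ k, D k ⊆ E := fun k => by
    induction k with
    | zero => exact Set.subset_union_left
    | succ k ih =>
      rw [hDsucc]
      split_ifs with hk
      exacts [Set.union_subset ih (hhump k hk), ih]
  -- The charge of `E` at the index `n k` exceeds `ρ (D k)` substantially if and only if `k` is
  -- even, which contradicts convergence.
  have heven : ∀ k, Even k → ρ (D k) + (c - 3 * ε) ≤ r (n k) E := fun k hk => by
    have h1 := (hr (n k)).add_sdiff (hAm (k + 1)) (hAm k) (hsub k)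
    have h2 := (hr (n k)).union _ (hDm k) _ (sdiff_mem (hAm k) (hAm (k + 1)))
      ((hdisj k).symm.mono_right Set.sdiff_subset)
    have h3 := (hr (n k)).mono (union_mem (hDm k) (sdiff_mem (hAm k) (hAm (k + 1)))) hE
      (Set.union_subset (hsubE k) (hhump k hk))
    linarith [hbig k, hnext k, (abs_lt.1 (hclose k)).1]
  have hodd : ∀ k, ¬ Even k → r (n k) E ≤ ρ (D k) + 2 * ε := fun k hk => by
    have h1 := (hr (n k)).union_le (hDm k) (hAm (k + 1))
    have h2 := hEsub (k + 1)
    rw [hDsucc, if_neg hk] at h2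
    have h3 := (hr (n k)).mono hE (union_mem (hDm k) (hAm (k + 1))) h2
    linarith [hnext k, (abs_lt.1 (hclose k)).2]
  obtain ⟨l, hl⟩ : ∃ l, Tendsto (fun k => ρ (D k)) atTop (𝓝 l) :=
    ⟨_, tendsto_atTop_ciSup (fun i j hij => hρ.mono (hDm i) (hDm j) (hDmono hij))
      ⟨ρ E, by rintro _ ⟨k, rfl⟩; exact hρ.mono (hDm k) hE (hsubE k)⟩⟩
  have hrE : Tendsto (fun k => r (n k) E) atTop (𝓝 (ρ E)) :=
    (hlim E hE).comp (tendsto_atTop_mono hn tendsto_id)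
  have h2j : Tendsto (fun j : ℕ => 2 * j) atTop atTop :=
    tendsto_atTop_mono (fun j => by simp only [id]; omega) tendsto_id
  have h2j' : Tendsto (fun j : ℕ => 2 * j + 1) atTop atTop :=
    tendsto_atTop_mono (fun j => by simp only [id]; omega) tendsto_id
  have hlow := le_of_tendsto_of_tendsto' ((hl.comp h2j).add_const (c - 3 * ε)) (hrE.comp h2j)
    fun j => heven _ (even_two_mul j)
  have hupp := le_of_tendsto_of_tendsto' (hrE.comp h2j') ((hl.comp h2j').add_const (2 * ε))
    fun j => hodd _ (by simp)
  linarith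

end ChargeSequence

/-! ### Stone spaces -/

section StoneSpace

open BooleanSubalgebra

variable {𝔹 : BooleanSubalgebra (Set ℕ)} {A C : Set ℕ}

theorem stoneClopen_univ : stoneClopen 𝔹 Set.univ = Set.univ :=
  Set.eq_univ_of_forall fun u => u.2.univ_mem

theorem stoneClopen_empty : stoneClopen 𝔹 ∅ = ∅ :=
  Set.eq_empty_of_forall_notMem fun u => u.2.empty_notMem

theorem stoneClopen_inter (hA : A ∈ 𝔹) (hC : C ∈ 𝔹) :
    stoneClopen 𝔹 (A ∩ C) = stoneClopen 𝔹 A ∩ stoneClopen 𝔹 C := by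
  ext u
  exact ⟨fun h => ⟨u.2.mem_of_superset _ h _ hA Set.inter_subset_left,
    u.2.mem_of_superset _ h _ hC Set.inter_subset_right⟩, fun h => u.2.inter_mem _ h.1 _ h.2⟩

theorem stoneClopen_compl (hA : A ∈ 𝔹) : stoneClopen 𝔹 Aᶜ = (stoneClopen 𝔹 A)ᶜ := by
  ext u
  refine ⟨fun h h' => u.2.empty_notMem ?_, fun h => (u.2.mem_or_compl_mem A hA).resolve_left h⟩
  simpa using u.2.inter_mem _ h' _ h

theorem stoneClopen_union (hA : A ∈ 𝔹) (hC : C ∈ 𝔹) :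
    stoneClopen 𝔹 (A ∪ C) = stoneClopen 𝔹 A ∪ stoneClopen 𝔹 C := by
  rw [← compl_compl (A ∪ C), Set.compl_union,
    stoneClopen_compl (inter_mem (compl_mem hA) (compl_mem hC)),
    stoneClopen_inter (compl_mem hA) (compl_mem hC), stoneClopen_compl hA, stoneClopen_compl hC,
    Set.compl_inter, compl_compl, compl_compl]

theorem stoneClopen_biUnion_lt {X : ℕ → Set ℕ} (hX : ∀ k, X k ∈ 𝔹) (N : ℕ) :
    stoneClopen 𝔹 (⋃ k < N, X k) = ⋃ k < N, stoneClopen 𝔹 (X k) := by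
  induction N with
  | zero => simp [stoneClopen_empty]
  | succ N ih =>
    rw [Set.biUnion_lt_succ, Set.biUnion_lt_succ, stoneClopen_union (biUnion_lt_mem hX N) (hX N),
      ih]

theorem isOpen_stoneClopen (hA : A ∈ 𝔹) : IsOpen (stoneClopen 𝔹 A) :=
  TopologicalSpace.isOpen_generateFrom_of_mem ⟨A, hA, rfl⟩

theorem isClopen_stoneClopen (hA : A ∈ 𝔹) : IsClopen (stoneClopen 𝔹 A) := by
  refine ⟨⟨?_⟩, isOpen_stoneClopen hA⟩
  rw [← stoneClopen_compl hA]
  exact isOpen_stoneClopen (compl_mem hA)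

theorem measurableSet_stoneClopen (hA : A ∈ 𝔹) : MeasurableSet (stoneClopen 𝔹 A) :=
  (isOpen_stoneClopen hA).measurableSet

instance : T2Space (StoneSpace 𝔹) := by
  refine ⟨fun u v huv => ?_⟩
  have hsep : ∃ A ∈ u.1, A ∉ v.1 := by
    by_contra! h
    refine huv (Subtype.ext (Set.Subset.antisymm h fun A hA => ?_))
    refine (u.2.mem_or_compl_mem A (v.2.subset A hA)).resolve_right fun hA' => v.2.empty_notMem ?_
    simpa using v.2.inter_mem _ hA _ (h _ hA')
  obtain ⟨A, hu, hv⟩ := hsep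
  have hA := u.2.subset A hu
  exact ⟨_, _, isOpen_stoneClopen hA, (isClopen_stoneClopen hA).compl.isOpen, hu, hv,
    disjoint_compl_right⟩

theorem isTopologicalBasis_stoneClopen :
    TopologicalSpace.IsTopologicalBasis {U | ∃ A ∈ 𝔹, U = stoneClopen 𝔹 A} where
  exists_subset_inter := by
    rintro _ ⟨A, hA, rfl⟩ _ ⟨C, hC, rfl⟩ u hu
    rw [← stoneClopen_inter hA hC] at hu ⊢
    exact ⟨_, ⟨_, inter_mem hA hC, rfl⟩, hu, subset_rfl⟩
  sUnion_eq := Set.eq_univ_of_forall fun u =>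
    ⟨_, ⟨_, univ_mem, rfl⟩, u.2.univ_mem⟩
  eq_generateFrom := rfl

theorem IsCompact.exists_stoneClopen {K V : Set (StoneSpace 𝔹)} (hK : IsCompact K) (hV : IsOpen V)
    (hKV : K ⊆ V) : ∃ A ∈ 𝔹, K ⊆ stoneClopen 𝔹 A ∧ stoneClopen 𝔹 A ⊆ V := by
  refine hK.induction_on (p := fun K => ∃ A ∈ 𝔹, K ⊆ stoneClopen 𝔹 A ∧ stoneClopen 𝔹 A ⊆ V)
    ⟨∅, empty_mem, by simp [stoneClopen_empty]⟩ ?_ ?_ ?_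
  · rintro s t hst ⟨A, hA, h1, h2⟩
    exact ⟨A, hA, hst.trans h1, h2⟩
  · rintro s t ⟨A, hA, h1, h2⟩ ⟨C, hC, h3, h4⟩
    refine ⟨A ∪ C, union_mem hA hC, ?_⟩
    rw [stoneClopen_union hA hC]
    exact ⟨Set.union_subset_union h1 h3, Set.union_subset h2 h4⟩
  · intro u hu
    obtain ⟨_, ⟨A, hA, rfl⟩, huA, hAV⟩ :=
      isTopologicalBasis_stoneClopen.exists_subset_of_mem_open (hKV hu) hV
    exact ⟨stoneClopen 𝔹 A, mem_nhdsWithin_of_mem_nhds ((isOpen_stoneClopen hA).mem_nhds huA), A,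
      hA, subset_rfl, hAV⟩

theorem isCharge_stoneClopen (ν : ProbabilityMeasure (StoneSpace 𝔹)) :
    IsCharge 𝔹 fun A => (ν : Measure (StoneSpace 𝔹)).real (stoneClopen 𝔹 A) where
  nonneg _ _ := measureReal_nonneg
  union A hA C hC hAC := by
    rw [stoneClopen_union hA hC, measureReal_union ?_ (measurableSet_stoneClopen hC)]
    rw [Set.disjoint_iff_inter_eq_empty, ← stoneClopen_inter hA hC,
      Set.disjoint_iff_inter_eq_empty.1 hAC, stoneClopen_empty]
  univ := by simp [stoneClopen_univ]

theorem tendsto_stoneClopen {σ : ℕ → ProbabilityMeasure (StoneSpace 𝔹)}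
    {ν : ProbabilityMeasure (StoneSpace 𝔹)} (h : Tendsto σ atTop (𝓝 ν)) (hA : A ∈ 𝔹) :
    Tendsto (fun n => (σ n : Measure (StoneSpace 𝔹)).real (stoneClopen 𝔹 A)) atTop
      (𝓝 ((ν : Measure (StoneSpace 𝔹)).real (stoneClopen 𝔹 A))) := by
  have := ProbabilityMeasure.tendsto_iff_forall_integral_tendsto.1 h
    (BoundedContinuousFunction.indicator _ (isClopen_stoneClopen hA))
  simpa [integral_indicator_one (measurableSet_stoneClopen hA)] using this

end StoneSpace

/-! ### Measures in the sequential closure -/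

/-- Compact null sets have open neighbourhoods of arbitrarily small measure. This consequence of
outer regularity is easily checked for finite combinations of Dirac measures. -/
def HasSmallNeighborhoods {K : Type*} [TopologicalSpace K] [MeasurableSpace K]
    (σ : Measure K) : Prop :=
  ∀ C, IsCompact C → σ C = 0 → ∀ ε > 0, ∃ V, IsOpen V ∧ C ⊆ V ∧ σ V < ε

/-- Borel subsets of `Uᶜ` that are `ρ`-null and contain no atoms of `σ` are `σ`-null. This is a
reformulation of almost absolute continuity that avoids the non-atomic part. -/
def IsNullOffAtoms {K : Type*} [MeasurableSpace K] (U : Set K) (σ ρ : Measure K) : Prop :=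
  ∀ E, MeasurableSet E → E ⊆ Uᶜ → ρ E = 0 → (∀ x ∈ E, σ {x} = 0) → σ E = 0

section General

variable {K : Type*} [MeasurableSpace K]

theorem hasSmallNeighborhoods_of_outerRegular [TopologicalSpace K] (σ : Measure K) [σ.OuterRegular] :
    HasSmallNeighborhoods σ := fun C _ hC0 ε hε => by
  obtain ⟨V, hCV, hV, hlt⟩ := C.exists_isOpen_lt_of_lt ε (hC0 ▸ hε)
  exact ⟨V, hV, hCV, hlt⟩

theorem countable_setOf_atom [MeasurableSingletonClass K] (σ : Measure K) [IsFiniteMeasure σ] :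
    {x | σ {x} ≠ 0}.Countable := by
  have := Measure.countable_meas_pos_of_disjoint_iUnion (μ := σ) (As := fun x : K => {x})
    (fun x => measurableSet_singleton x) (fun x y hxy => by simpa using hxy)
  simpa [pos_iff_ne_zero] using this

theorem IsNullOffAtoms.almostAbsolutelyContinuous [MeasurableSingletonClass K] {U : Set K}
    {σ ρ : Measure K} [IsFiniteMeasure σ] (hU : MeasurableSet U) (h : IsNullOffAtoms U σ ρ) :
    AlmostAbsolutelyContinuous U σ ρ := by
  refine Measure.AbsolutelyContinuous.mk fun E hE hρE => ?_
  have hG : MeasurableSet {x | σ.restrict Uᶜ {x} = 0} := by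
    have := (countable_setOf_atom (σ.restrict Uᶜ)).measurableSet.compl
    simpa [Set.compl_ofPred] using this
  rw [nonatomicPart, Measure.restrict_apply hE, Measure.restrict_apply' hU.compl]
  refine h _ ((hE.inter hG).inter hU.compl) Set.inter_subset_right
    (measure_mono_null (Set.inter_subset_left.trans Set.inter_subset_left) hρE) fun x hx => ?_
  have h0 : σ.restrict Uᶜ {x} = 0 := hx.1.2
  rw [Measure.restrict_apply (measurableSet_singleton x)] at h0
  exact measure_mono_null (Set.singleton_subset_iff (s := {x} ∩ Uᶜ).2 ⟨rfl, hx.2⟩) h0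

variable (s : Finset K) (w : K → ℝ≥0)

theorem finsum_dirac_eq_zero_iff {E : Set K} (hE : MeasurableSet E) :
    (∑ x ∈ s, w x • Measure.dirac x : Measure K) E = 0 ↔ ∀ x ∈ s, x ∈ E → w x = 0 := by
  simp only [Measure.coe_finsetSum, Finset.sum_apply, Measure.smul_apply,
    Measure.dirac_apply' _ hE, Finset.sum_eq_zero_iff]
  refine forall₂_congr fun x _ => ?_
  by_cases hx : x ∈ E <;> simp [hx, ENNReal.smul_def]

theorem hasSmallNeighborhoods_sum_dirac [TopologicalSpace K] [T2Space K] [BorelSpace K] :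
    HasSmallNeighborhoods (∑ x ∈ s, w x • Measure.dirac x : Measure K) := fun C hC hC0 ε hε => by
  classical
  have hV : IsOpen ((↑(s.filter (· ∉ C)) : Set K)ᶜ) := (Finset.finite_toSet _).isClosed.isOpen_compl
  refine ⟨_, hV, fun x hx => by simp [hx], ?_⟩
  rw [(finsum_dirac_eq_zero_iff s w hV.measurableSet).2 fun x hxs hx => ?_]
  · exact hε
  · exact (finsum_dirac_eq_zero_iff s w hC.measurableSet).1 hC0 x hxs (by simp at hx; tauto)

theorem isNullOffAtoms_sum_dirac [MeasurableSingletonClass K] (U : Set K) (ρ : Measure K) :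
    IsNullOffAtoms U (∑ x ∈ s, w x • Measure.dirac x : Measure K) ρ := fun _ hE _ _ hat =>
  (finsum_dirac_eq_zero_iff s w hE).2 fun x hxs hx =>
    (finsum_dirac_eq_zero_iff s w (measurableSet_singleton x)).1 (hat x hx) x hxs rfl

end General

namespace ChargeSequence

open BooleanSubalgebra

variable {S : ChargeSequence} {m : Set ℕ → ℝ} {μ : Measure (StoneSpace S.algebra)}

/-- A compact `μ`-null set outside of all blocks that is null for all terms of a convergent
sequence of measures is null for the limit. -/
theorem measure_eq_zero_of_tendsto
    (hm : ∀ A ∈ S.algebra, Tendsto (fun n => S.charge n A) atTop (𝓝 (m A)))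
    (hμ : IsRadonExtension S.algebra m μ)
    {σ : ℕ → ProbabilityMeasure (StoneSpace S.algebra)}
    {ν : ProbabilityMeasure (StoneSpace S.algebra)} (hσ : Tendsto σ atTop (𝓝 ν))
    (hnhds : ∀ n, HasSmallNeighborhoods (σ n : Measure (StoneSpace S.algebra)))
    {C : Set (StoneSpace S.algebra)} (hC : IsCompact C)
    (hCU : C ⊆ (⋃ n, stoneClopen S.algebra (S.block n))ᶜ) (hμC : μ C = 0)
    (hσC : ∀ n, (σ n : Measure (StoneSpace S.algebra)) C = 0) :
    (ν : Measure (StoneSpace S.algebra)) C = 0 := by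
  rw [← measureReal_eq_zero_iff]
  refine le_antisymm ?_ measureReal_nonneg
  refine nonpos_of_forall_le (fun n => isCharge_stoneClopen (σ n)) (isCharge_stoneClopen ν)
    (fun A hA => tendsto_stoneClopen hσ hA)
    (F := {A | A ∈ S.algebra ∧ C ⊆ stoneClopen S.algebra A}) (fun A hA => hA.1)
    ⟨Set.univ, univ_mem, by simp [stoneClopen_univ]⟩ ?_ fun A hA => measureReal_mono hA.2
  rintro A ⟨hA, hCA⟩ k i ε hε
  have := hμ.regular
  obtain ⟨V, hV, hCV, hVε⟩ := hasSmallNeighborhoods_of_outerRegular μ C hC hμC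
    (ENNReal.ofReal ((1 / 2) ^ k)) (by positivity)
  obtain ⟨W, hW, hCW, hWε⟩ := hnhds i C hC (hσC i) (ENNReal.ofReal ε) (by positivity)
  obtain ⟨A', hA', hCA', hA'sub⟩ := hC.exists_stoneClopen
    ((hV.inter hW).inter (isOpen_stoneClopen hA)) (Set.subset_inter (Set.subset_inter hCV hCW) hCA)
  have hA'V := hA'sub.trans (Set.inter_subset_left.trans Set.inter_subset_left)
  have hA'W := hA'sub.trans (Set.inter_subset_left.trans Set.inter_subset_right)
  have hmA' : m (A' ∩ A) < (1 / 2) ^ k := by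
    refine (ENNReal.ofReal_lt_ofReal_iff (by positivity)).1 ?_
    rw [← hμ.extends_content _ (inter_mem hA' hA), stoneClopen_inter hA' hA]
    exact (measure_mono (Set.inter_subset_left.trans hA'V)).trans_lt hVε
  obtain ⟨N, hN⟩ := exists_isSmall_sdiff (inter_mem hA' hA) (hm _ (inter_mem hA' hA)) hmA'
  have hblocks : (⋃ j < N, S.block j) ∈ S.algebra := biUnion_lt_mem block_mem_algebra N
  have hmem := sdiff_mem (inter_mem hA' hA) hblocks
  -- Points of `C` contain no blocks, so `C` is not affected by the removal of finitely many blocks.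
  have hCblocks : ∀ u ∈ C, (⋃ j < N, S.block j) ∉ u.1 := by
    intro u hu
    change u ∉ stoneClopen S.algebra _
    rw [stoneClopen_biUnion_lt block_mem_algebra]
    exact fun h => hCU hu (Set.iUnion₂_subset_iUnion _ _ h)
  refine ⟨_, ⟨hmem, fun u hu => ?_⟩, Set.sdiff_subset.trans Set.inter_subset_right, hN, ?_⟩
  · exact u.2.inter_mem _ (u.2.inter_mem _ (hCA' hu) _ (hCA hu)) _
      ((u.2.mem_or_compl_mem _ hblocks).resolve_left (hCblocks u hu))
  · refine (ENNReal.ofReal_lt_ofReal_iff hε).1 ?_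
    rw [ofReal_measureReal]
    refine (measure_mono fun u hu => hA'W ?_).trans_lt hWε
    exact u.2.mem_of_superset _ hu _ hA' (Set.sdiff_subset.trans Set.inter_subset_left)

theorem isNullOffAtoms_of_inSeqHierarchy
    (hm : ∀ A ∈ S.algebra, Tendsto (fun n => S.charge n A) atTop (𝓝 (m A)))
    (hμ : IsRadonExtension S.algebra m μ) {α : Ordinal.{0}}
    {ν : ProbabilityMeasure (StoneSpace S.algebra)}
    (hν : InSeqHierarchy (Set.univ : Set (StoneSpace S.algebra)) α ν) :
    HasSmallNeighborhoods (ν : Measure (StoneSpace S.algebra)) ∧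
      IsNullOffAtoms (⋃ n, stoneClopen S.algebra (S.block n))
        (ν : Measure (StoneSpace S.algebra)) μ := by
  induction hν with
  | finite s w hs hw hν =>
    rw [hν]
    exact ⟨hasSmallNeighborhoods_sum_dirac s w, isNullOffAtoms_sum_dirac s w _ μ⟩
  | @limit α ν hreg σ β hβ hσ hlim ih =>
    refine ⟨hasSmallNeighborhoods_of_outerRegular _, fun E hE hEU hμE hat => ?_⟩
    -- Remove the countably many atoms of the measures `σ n`.
    set T := ⋃ n, {x | (σ n : Measure (StoneSpace S.algebra)) {x} ≠ 0} with hT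
    have hTc : T.Countable := Set.countable_iUnion fun n => countable_setOf_atom _
    have hET : (ν : Measure (StoneSpace S.algebra)) (E ∩ T) = 0 := by
      rw [← Set.biUnion_of_singleton (E ∩ T)]
      exact (measure_biUnion_null_iff (hTc.mono Set.inter_subset_right)).2 fun x hx => hat x hx.1
    rw [← Set.inter_union_sdiff E T]
    refine measure_union_null hET ?_
    by_contra hne
    obtain ⟨C, hCE, hC, hpos⟩ := (hE.diff hTc.measurableSet).exists_lt_isCompact_of_ne_top
      (measure_ne_top _ _) (pos_iff_ne_zero.2 hne)
    refine hpos.ne' ?_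
    have hCU := (hCE.trans Set.sdiff_subset).trans hEU
    have hμC := measure_mono_null (hCE.trans Set.sdiff_subset) hμE
    refine measure_eq_zero_of_tendsto hm hμ hlim (fun n => (ih n).1) hC hCU hμC fun n =>
      (ih n).2 C hC.measurableSet hCU hμC fun x hx => ?_
    by_contra hx'
    exact (hCE hx).2 (Set.mem_iUnion.2 ⟨n, hx'⟩)

end ChargeSequence

/-! ### The stages of the construction -/

open BooleanSubalgebra

theorem ChargeSequence.isCharge_of_tendsto {S : ChargeSequence} {m : Set ℕ → ℝ}
    (hm : ∀ A ∈ S.algebra, Tendsto (fun n => S.charge n A) atTop (𝓝 (m A))) :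
    IsCharge S.algebra m where
  nonneg A hA := ge_of_tendsto' (hm A hA) fun n => (S.isCharge n).nonneg A hA.1
  union A hA C hC hAC := by
    refine tendsto_nhds_unique (hm _ (union_mem hA hC)) ?_
    simpa only [(S.isCharge _).union A hA.1 C hC.1 hAC] using (hm A hA).add (hm C hC)
  univ := by
    refine tendsto_nhds_unique (hm _ univ_mem) ?_
    simp only [(S.isCharge _).univ, tendsto_const_nhds]

theorem isCharge_ncard_div (n : ℕ) :
    IsCharge ⊤ fun A => ((A ∩ Set.Iic n).ncard : ℝ) / ((n : ℝ) + 1) where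
  nonneg _ _ := by positivity
  union A _ C _ hAC := by
    rw [Set.union_inter_distrib_right, Set.ncard_union_eq
      (hAC.mono Set.inter_subset_left Set.inter_subset_left)
      ((Set.finite_Iic n).inter_of_right A) ((Set.finite_Iic n).inter_of_right C)]
    push_cast
    ring
  univ := by
    rw [Set.univ_inter, ← Finset.coe_Iic, Set.ncard_coe_finset, Nat.card_Iic]
    push_cast
    exact div_self (by positivity)

theorem hasDensity_singleton (j : ℕ) : HasDensity {j} 0 := by
  refine squeeze_zero (fun n => by positivity) (fun n => ?_) tendsto_one_div_add_atTop_nhds_zero_nat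
  gcongr
  exact_mod_cast (Set.ncard_le_ncard Set.inter_subset_left).trans (Set.ncard_singleton j).le

/-- The sequence of normalized counting measures, which defines the asymptotic density. -/
noncomputable def densityChargeSequence (φ : Set unitInterval → Set ℕ)
    (hφ : IsHomModulo {Z | HasDensity Z 0} φ)
    (hφd : ∀ s, MeasurableSet s → HasDensity (φ s) (volume.real s)) : ChargeSequence where
  domain := ⊤
  charge n A := ((A ∩ Set.Iic n).ncard : ℝ) / ((n : ℝ) + 1)
  block j := {j}
  lift := φ
  isCharge := isCharge_ncard_div
  block_mem _ := mem_top
  tendsto_block := hasDensity_singleton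
  charge_eq_zero n A _ hA := by
    have : A ∩ Set.Iic n = ∅ := Set.eq_empty_of_forall_notMem fun j hj =>
      Set.disjoint_singleton_right.1 (hA j hj.2) hj.1
    simp [this]
  iUnion_mem _ _ _ := mem_top
  lift_mem _ _ := mem_top
  tendsto_lift := hφd
  lift_union := hφ.union
  lift_compl := hφ.compl

theorem algebra_densityChargeSequence (φ : Set unitInterval → Set ℕ)
    (hφ : IsHomModulo {Z | HasDensity Z 0} φ)
    (hφd : ∀ s, MeasurableSet s → HasDensity (φ s) (volume.real s)) :
    (densityChargeSequence φ hφ hφd).algebra = BooleanSubalgebra.closure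
      ({Z | HasDensity Z 0} ∪ {A | ∃ s, MeasurableSet s ∧ A = φ s}) := by
  refine le_antisymm ?_ (closure_le.2 ?_)
  · rintro A ⟨-, s, hs, -, hAs⟩
    rw [← symmDiff_symmDiff_cancel_right (φ s) A]
    exact symmDiff_mem (subset_closure (.inl hAs)) (subset_closure (.inr ⟨s, hs, rfl⟩))
  · rintro A (hA | ⟨s, hs, rfl⟩)
    · exact ChargeSequence.IsNull.mem_algebra ⟨mem_top, hA⟩
    · exact (densityChargeSequence φ hφ hφd).lift_mem_algebra hs

section Step

variable {B : ℕ → Set ℕ}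

theorem traceOn_union (n : ℕ) (A C : Set ℕ) :
    traceOn B n (A ∪ C) = traceOn B n A ∪ traceOn B n C := rfl

theorem traceOn_compl (n : ℕ) (A : Set ℕ) : traceOn B n Aᶜ = (traceOn B n A)ᶜ := rfl

theorem traceOn_symmDiff (n : ℕ) (A C : Set ℕ) :
    traceOn B n (A ∆ C) = traceOn B n A ∆ traceOn B n C := rfl

theorem traceOn_iUnion_copyIn (hB_inf : ∀ n, (B n).Infinite)
    (hB_disj : ∀ i j, i ≠ j → Disjoint (B i) (B j)) (X : ℕ → Set ℕ) (n : ℕ) :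
    traceOn B n (⋃ k, copyIn B k (X k)) = X n := by
  have hmem : ∀ k i, Nat.nth (fun x => x ∈ B k) i ∈ B k := fun k =>
    Nat.nth_mem_of_infinite (hB_inf k)
  ext i
  simp only [traceOn, copyIn, Set.mem_ofPred_eq, Set.mem_iUnion, Set.mem_image]
  refine ⟨?_, fun hi => ⟨n, i, hi, rfl⟩⟩
  rintro ⟨k, i', hi', heq⟩
  obtain rfl : k = n := by
    by_contra hkn
    exact Set.disjoint_left.1 (hB_disj k n hkn) (hmem k i') (heq ▸ hmem n i)
  rwa [← Nat.nth_injective (hB_inf k) heq]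

theorem traceOn_eq_empty (hB_inf : ∀ n, (B n).Infinite) {n : ℕ} {A : Set ℕ}
    (hA : Disjoint A (B n)) : traceOn B n A = ∅ :=
  Set.eq_empty_of_forall_notMem fun i hi =>
    Set.disjoint_left.1 hA hi (Nat.nth_mem_of_infinite (hB_inf n) i)

theorem traceOn_self (hB_inf : ∀ n, (B n).Infinite) (n : ℕ) : traceOn B n (B n) = Set.univ :=
  Set.eq_univ_of_forall fun i => Nat.nth_mem_of_infinite (hB_inf n) i

/-- The sets all of whose traces belong to the given algebras. -/
def traceAlgebra (B : ℕ → Set ℕ) (𝔹s : ℕ → BooleanSubalgebra (Set ℕ)) :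
    BooleanSubalgebra (Set ℕ) where
  carrier := {A | ∀ n, traceOn B n A ∈ 𝔹s n}
  supClosed' _ hA _ hC n := union_mem (hA n) (hC n)
  infClosed' _ hA _ hC n := inter_mem (hA n) (hC n)
  compl_mem' hA n := compl_mem (hA n)
  bot_mem' _ := empty_mem

variable {𝔹s : ℕ → BooleanSubalgebra (Set ℕ)} {ms : ℕ → Set ℕ → ℝ}
  {φs : ℕ → Set unitInterval → Set ℕ}

/-- The sequence of charges that defines the measure on the canonical algebra. -/
def canonicalChargeSequence (hB_inf : ∀ n, (B n).Infinite)
    (hB_disj : ∀ i j, i ≠ j → Disjoint (B i) (B j)) (hms : ∀ n, IsCharge (𝔹s n) (ms n))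
    (hφs : ∀ n, IsMetricIso (𝔹s n) (ms n) (φs n)) : ChargeSequence where
  domain := traceAlgebra B 𝔹s
  charge n A := ms n (traceOn B n A)
  block := B
  lift s := ⋃ n, copyIn B n (φs n s)
  isCharge n :=
    { nonneg := fun _ hA => (hms n).nonneg _ (hA n)
      union := fun _ hA _ hC hAC => (hms n).union _ (hA n) _ (hC n) (hAC.preimage _)
      univ := (hms n).univ }
  block_mem j n := by
    rcases eq_or_ne j n with rfl | hjn
    · rw [traceOn_self hB_inf]
      exact univ_mem
    · rw [traceOn_eq_empty hB_inf (hB_disj j n hjn)]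
      exact empty_mem
  tendsto_block j := by
    refine tendsto_const_nhds.congr' ?_
    filter_upwards [eventually_gt_atTop j] with n hn
    rw [traceOn_eq_empty hB_inf (hB_disj j n hn.ne), (hms n).empty]
  charge_eq_zero n A _ hA := by
    rw [traceOn_eq_empty hB_inf (hA n le_rfl), (hms n).empty]
  iUnion_mem X hX hXB n := by
    have h : traceOn B n (⋃ k, X k) = ⋃ k < n + 1, traceOn B n (X k) := by
      ext i
      simp only [traceOn, Set.mem_ofPred_eq, Set.mem_iUnion, exists_prop]
      refine ⟨?_, fun ⟨k, _, hk⟩ => ⟨k, hk⟩⟩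
      rintro ⟨k, hk⟩
      refine ⟨k, ?_, hk⟩
      by_contra hkn
      exact Set.disjoint_left.1 (hXB k n (by omega)) hk (Nat.nth_mem_of_infinite (hB_inf n) i)
    rw [h]
    exact biUnion_lt_mem (fun k => hX k n) _
  lift_mem s hs n := by
    rw [traceOn_iUnion_copyIn hB_inf hB_disj]
    exact (hφs n).mem s hs
  tendsto_lift s hs := by
    simp only [traceOn_iUnion_copyIn hB_inf hB_disj, (hφs _).measure s hs, tendsto_const_nhds]
  lift_union s t hs ht := by
    have h : ∀ n, traceOn B n ((⋃ n, copyIn B n (φs n (s ∪ t))) ∆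
        ((⋃ n, copyIn B n (φs n s)) ∪ ⋃ n, copyIn B n (φs n t))) =
        φs n (s ∪ t) ∆ (φs n s ∪ φs n t) := fun n => by
      simp only [traceOn_symmDiff, traceOn_union, traceOn_iUnion_copyIn hB_inf hB_disj]
    simp only [h, ((hφs _).hom.union s t hs ht).2, tendsto_const_nhds]
  lift_compl s hs := by
    have h : ∀ n, traceOn B n ((⋃ n, copyIn B n (φs n sᶜ)) ∆ (⋃ n, copyIn B n (φs n s))ᶜ) =
        φs n sᶜ ∆ (φs n s)ᶜ := fun n => by
      simp only [traceOn_symmDiff, traceOn_compl, traceOn_iUnion_copyIn hB_inf hB_disj]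
    simp only [h, ((hφs _).hom.compl s hs).2, tendsto_const_nhds]

theorem algebra_canonicalChargeSequence (hB_inf : ∀ n, (B n).Infinite)
    (hB_disj : ∀ i j, i ≠ j → Disjoint (B i) (B j)) (hms : ∀ n, IsCharge (𝔹s n) (ms n))
    (hφs : ∀ n, IsMetricIso (𝔹s n) (ms n) (φs n)) :
    (canonicalChargeSequence hB_inf hB_disj hms hφs).algebra = canonicalAlgebra B 𝔹s ms φs := by
  set S := canonicalChargeSequence hB_inf hB_disj hms hφs with hS
  -- A set is null if and only if its complement has traces whose measures converge to `1`.
  have hcompl : ∀ A ∈ S.domain, ∀ n, ms n (traceOn B n Aᶜ) = 1 - ms n (traceOn B n A) :=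
    fun A hA n => (S.isCharge n).compl hA
  refine le_antisymm ?_ (closure_le.2 ?_)
  · rintro A ⟨-, s, hs, hdom, hAs⟩
    rw [← symmDiff_symmDiff_cancel_right (S.lift s) A]
    refine symmDiff_mem ?_ (subset_closure (.inr ⟨s, hs, rfl⟩))
    rw [← compl_mem_iff]
    refine subset_closure (.inl ⟨compl_mem hdom, ?_⟩)
    simp only [hcompl _ hdom]
    have h := hAs.const_sub 1
    rw [sub_zero] at h
    exact h
  · rintro A (⟨hA, hA1⟩ | ⟨s, hs, rfl⟩)
    · refine compl_mem_iff.1 (ChargeSequence.IsNull.mem_algebra ⟨compl_mem hA, ?_⟩)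
      change Tendsto (fun n => ms n (traceOn B n Aᶜ)) atTop (𝓝 0)
      simp only [hcompl A hA]
      simpa using hA1.const_sub 1
    · exact S.lift_mem_algebra hs

end Step

/-- Every stage of the construction is the algebra of a sequence of charges, with the expected
blocks. -/
theorem IsStage.exists_chargeSequence {B : ℕ → Set ℕ} (hB_inf : ∀ n, (B n).Infinite)
    (hB_disj : ∀ i j, i ≠ j → Disjoint (B i) (B j)) {α : Ordinal.{0}}
    {𝔹 : BooleanSubalgebra (Set ℕ)} {m : Set ℕ → ℝ} (h : IsStage B α 𝔹 m) :
    1 ≤ α ∧ ∃ S : ChargeSequence, S.algebra = 𝔹 ∧ S.block = block B α ∧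
      ∀ A ∈ 𝔹, Tendsto (fun n => S.charge n A) atTop (𝓝 (m A)) := by
  induction h with
  | one hα φ hφ hφd h𝔹 hm =>
    refine ⟨hα.ge, densityChargeSequence φ hφ hφd, ?_, ?_, hm⟩
    · rw [h𝔹, algebra_densityChargeSequence]
    · ext1 j
      simp [densityChargeSequence, block, hα]
  | @step α 𝔹 m a ha 𝔹s ms φs hs hφs hα h𝔹 hm ih =>
    have hms : ∀ n, IsCharge (𝔹s n) (ms n) := fun n => by
      obtain ⟨-, S, hS, -, hSm⟩ := ih n
      rw [← hS] at hSm ⊢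
      exact ChargeSequence.isCharge_of_tendsto hSm
    -- The stage is at least `2`, so the blocks are the sets `B n`.
    have hα1 : 1 < α := by
      rw [hα]
      exact ((ih 0).1.trans_lt (Order.lt_add_one_iff.2 le_rfl)).trans_le
        (Ordinal.le_iSup (fun n => a n + 1) 0)
    refine ⟨hα1.le, canonicalChargeSequence hB_inf hB_disj hms hφs, ?_, ?_, hm⟩
    · rw [h𝔹, algebra_canonicalChargeSequence]
    · ext1 j
      simp [canonicalChargeSequence, block, hα1.ne']

theorem corollary3p5
    (B : ℕ → Set ℕ) (hB_inf : ∀ n, (B n).Infinite)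
    (hB_disj : ∀ i j, i ≠ j → Disjoint (B i) (B j)) (hB_cover : ⋃ n, B n = Set.univ)
    (α : Ordinal.{0}) (hα_pos : 1 ≤ α) (hα_countable : α < Ordinal.omega 1)
    (𝔹 : BooleanSubalgebra (Set ℕ)) (m : Set ℕ → ℝ) (h𝔹 : IsStage B α 𝔹 m)
    (μ : Measure (StoneSpace 𝔹)) (hμ : IsRadonExtension 𝔹 m μ)
    (ν : ProbabilityMeasure (StoneSpace 𝔹)) (hν : ν ∈ seqClosureOfFinite (StoneSpace 𝔹)) :
    AlmostAbsolutelyContinuous (⋃ n, stoneClopen 𝔹 (block B α n)) (ν : Measure (StoneSpace 𝔹)) μ := by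
  obtain ⟨-, S, rfl, hblock, hm⟩ := h𝔹.exists_chargeSequence hB_inf hB_disj
  rw [← hblock]
  exact (ChargeSequence.isNullOffAtoms_of_inSeqHierarchy hm hμ hν).2.almostAbsolutelyContinuous
    (.iUnion fun n => measurableSet_stoneClopen (ChargeSequence.block_mem_algebra n))
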